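/- Let $\mathcal A$ be a finite alphabet and let $\Sigma\subset\mathcal A^{\mathbb Z}$ be a shift space, i.e. closed and invariant under the shift and its inverse. Let $\Sigma_n$ be the set of words of length $n$ occurring in points of $\Sigma$. Assume $\Sigma$ is irreducible: for any nonempty words $U_1,U_2$ occurring in $\Sigma$ there is a nonempty word $W$ occurring in $\Sigma$ such that $U_1WU_2$ occurs in $\Sigma$. The topological entropy is $h(\Sigma)=\lim_{n\to\infty}\frac1n\log|\Sigma_n|$. Let $\Sigma^-$ be the set of left-infinite sequences $\xi=(x_n)_{n\le 0}$ that extend to a point of $\Sigma$, and let $F(\xi)=\{\eta=(x_n)_{n\ge 1} : \xi\eta\in\Sigma\}$. The Krieger cover $\mathcal G_\infty$ of $\Sigma$ is the labeled graph whose vertices (states) are the classes $[\xi]$ of the relation $\xi_1\sim\xi_2\iff F(\xi_1)=F(\xi_2)$ on $\Sigma^-$, with an edge $[\xi]\overset{s}{\to}[\xi s]$ labeled $s\in\mathcal A$ whenever $\xi s\in\Sigma^-$. Let $\mathbb T_{i,j}$ be the number of edges from $i$ to $j$. Assume that $\mathcal G_\infty$ is right-resolving (edges with the same initial state carry different labels),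 that its states form a finite or countably infinite set, numbered $1,2,\dots$, and that $\mathbb T$ is irreducible (for all $i,j$ some $(\mathbb T^n)_{i,j}>0$ with $n\ge1$) and aperiodic (for every $i$, $\gcd\{n\ge1:(\mathbb T^n)_{i,i}>0\}=1$). Let $\lambda$ be the Perron value of $\mathbb T$, $\lambda=\lim_{n\to\infty}\sqrt[n]{(\mathbb T^n)_{i,j}}$; this limit exists, is finite and does not depend on $i,j$. Assume that $\mathbb T$ is positive recurrent, i.e. for every $i$, $\sum_{n\ge1}(\mathbb T^n)_{i,i}\lambda^{-n}=\infty$ and $\sum_{n\ge1}n\,\ell_{i,i}(n)\lambda^{-n}<\infty$, where $\ell_{i,j}(1)=\mathbb T_{i,j}$ and $\ell_{i,j}(n+1)=\sum_{r\ne i}\ell_{i,r}(n)\mathbb T_{r,j}$. Let $\mathcal B_n(\mathcal G_\infty)$ be the set of words of length $n$ occurring in label sequences of bi-infinite paths of $\mathcal G_\infty$, let $\mathcal B_{n;i,j}(\mathcal G_\infty)$ be the set of those which label a path from $i$ to $j$, and let $N^*_n$ be the smallest number such that $\mathcal B_n(\mathcal G_\infty)=\bigcup_{1\le i,j\le N^*_n}\mathcal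 B_{n;i,j}(\mathcal G_\infty)$. If (i) $\limsup_{n\to\infty}\frac{\log N^*_n}{n}=0$, and (ii) there are states $i^*,j^*$ such that $(\mathbb T^n)_{i^*,j^*}\ge(\mathbb T^n)_{i,j}$ for all $n\ge1$ and all $(i,j)\ne(i^*,j^*)$, then $h(\Sigma)=\log\lambda$. -/

import Mathlib

open Filter Topology
open scoped ENNReal

noncomputable section

namespace KriegerCover

/-! ### Words, irreducibility and entropy of a set of two-sided sequences -/

/-- The admissible patterns of length `n` of a set `X` of two-sided sequences. -/
def words {A : Type*} (X : Set (ℤ → A)) (n : ℕ) : Set (List A) :=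
  {w | ∃ x ∈ X, ∃ a : ℤ, w = List.ofFn fun k : Fin n => x (a + (k : ℕ))}

/-- All admissible patterns of positive length. -/
def language {A : Type*} (X : Set (ℤ → A)) : Set (List A) :=
  {w | ∃ n, 1 ≤ n ∧ w ∈ words X n}

/-- Any two admissible patterns can be joined by a third one. -/
def IsIrreducibleShift {A : Type*} (X : Set (ℤ → A)) : Prop :=
  ∀ u ∈ language X, ∀ v ∈ language X, ∃ w ∈ language X, u ++ w ++ v ∈ language X

/-- The topological entropy `lim (1/n) log |words X n|` exists and equals `h`. -/
def HasTopologicalEntropy {A : Type*} (X : Set (ℤ → A)) (h : ℝ) : Prop :=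
  Tendsto (fun n : ℕ => Real.log ((words X n).ncard : ℝ) / (n : ℝ)) atTop (𝓝 h)

/-! ### Countable non-negative matrices -/

/-- The powers of a non-negative, possibly infinite matrix. -/
def matPow {V : Type*} (T : V → V → ℝ≥0∞) : ℕ → V → V → ℝ≥0∞
  | 0, i, j => Set.indicator {i} 1 j
  | n + 1, i, j => ∑' k, matPow T n i k * T k j

/-- The first-return coefficients `l_{i,j}(n)`: `l(0) = 0`, `l(1) = T` and
`l_{i,j}(n+1) = ∑_{r ≠ i} l_{i,r}(n) T_{r,j}`. -/
def firstReturn {V : Type*} (T : V → V → ℝ≥0∞) : ℕ → V → V → ℝ≥0∞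
  | 0, _, _ => 0
  | 1, i, j => T i j
  | n + 2, i, j => ∑' r : {r : V // r ≠ i}, firstReturn T (n + 1) i r * T r j

def IsIrreducibleMatrix {V : Type*} (T : V → V → ℝ≥0∞) : Prop :=
  ∀ i j, ∃ n, 1 ≤ n ∧ 0 < matPow T n i j

/-- For every index `i` the greatest common divisor of `{n ≥ 1 | (T ^ n)_{i,i} > 0}` is one. -/
def IsAperiodicMatrix {V : Type*} (T : V → V → ℝ≥0∞) : Prop :=
  ∀ i, ∀ d : ℕ, (∀ n, 1 ≤ n → 0 < matPow T n i i → d ∣ n) → d = 1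

/-- The Perron value. When `T` is irreducible and aperiodic, `(T ^ n)_{i,j} ^ (1 / n)` converges
and the limit is the same for all `i, j`; the upper limit and the supremum only serve to make the
definition meaningful for every matrix. -/
def perronValue {V : Type*} (T : V → V → ℝ≥0∞) : ℝ≥0∞ :=
  ⨆ i, ⨆ j, limsup (fun n : ℕ => matPow T n i j ^ (1 / (n : ℝ))) atTop

/-- `T_{i,i}(1/λ) = ∑_{n ≥ 1} (T ^ n)_{i,i} / λ ^ n = ∞`. -/
def IsRecurrentMatrix {V : Type*} (T : V → V → ℝ≥0∞) : Prop :=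
  ∀ i, ∑' n : ℕ, matPow T (n + 1) i i / perronValue T ^ (n + 1) = ∞

/-- `T` is recurrent and `∑_{n ≥ 1} n l_{i,i}(n) / λ ^ n < ∞`. -/
def IsPositiveRecurrentMatrix {V : Type*} (T : V → V → ℝ≥0∞) : Prop :=
  IsRecurrentMatrix T ∧
    ∀ i, ∑' n : ℕ, (n : ℝ≥0∞) * firstReturn T n i i / perronValue T ^ n < ∞

/-! ### Labeled graphs -/

/-- A labeled graph with vertex set `V` and labels in `A`, in which there is at most one edge with
a given initial state, label and terminal state: `step i s j` says that there is an edge from `i`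
to `j` labeled `s`. -/
structure LabeledGraph (V A : Type*) where
  step : V → A → V → Prop

namespace LabeledGraph

variable {V A : Type*}

/-- Edges with the same initial state carry different labels. -/
def IsRightResolving (G : LabeledGraph V A) : Prop :=
  ∀ i s j j', G.step i s j → G.step i s j' → j = j'

/-- The adjacency matrix: the number of edges from `i` to `j`. -/
def adjacency (G : LabeledGraph V A) (i j : V) : ℝ≥0∞ :=
  (({s | G.step i s j}.encard : ℕ∞) : ℝ≥0∞)

/-- The label sequences of the bi-infinite paths. -/
def soficShift (G : LabeledGraph V A) : Set (ℤ → A) :=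
  {x | ∃ v : ℤ → V, ∀ n, G.step (v n) (x n) (v (n + 1))}

/-- `G.IsPath i w j`: the word `w` labels a path from `i` to `j`. -/
def IsPath (G : LabeledGraph V A) : V → List A → V → Prop
  | i, [], j => i = j
  | i, s :: w, j => ∃ k, G.step i s k ∧ G.IsPath k w j

/-- The admissible patterns of length `n` with initial state `i` and terminal state `j`. -/
def wordsBetween (G : LabeledGraph V A) (n : ℕ) (i j : V) : Set (List A) :=
  {w | w ∈ words G.soficShift n ∧ G.IsPath i w j}

/-- For vertices numbered by `e` (starting from `0`), the smallest `N` such that every admissible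
pattern of length `n` has an initial and a terminal state among those numbered `0, …, N - 1`. -/
def coverNumber (G : LabeledGraph V A) (e : V → ℕ) (n : ℕ) : ℕ :=
  sInf {N | words G.soficShift n =
    ⋃ (i : V) (j : V) (_ : e i < N) (_ : e j < N), G.wordsBetween n i j}

end LabeledGraph

/-! ### The Krieger cover -/

variable {A : Type*}

/-- The two-sided sequence `… ξ 2, ξ 1, ξ 0 . η 0, η 1, η 2 …`: a left ray `ξ` stands for
`(x_n)_{n ≤ 0}` with `x_{-k} = ξ k`, a right ray `η` for `(x_n)_{n ≥ 1}` with `x_{k+1} = η k`. -/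
def join (ξ η : ℕ → A) (n : ℤ) : A :=
  if n ≤ 0 then ξ (-n).toNat else η (n - 1).toNat

/-- The left rays of the sequences in `X`. -/
def leftRays (X : Set (ℤ → A)) : Set (ℕ → A) :=
  {ξ | ∃ η, join ξ η ∈ X}

/-- The future of a left ray. -/
def future (X : Set (ℤ → A)) (ξ : ℕ → A) : Set (ℕ → A) :=
  {η | join ξ η ∈ X}

/-- The left ray `ξ s`. -/
def snoc (ξ : ℕ → A) (s : A) : ℕ → A
  | 0 => s
  | k + 1 => ξ k

/-- Two left rays are equivalent if they have the same future. -/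
def futureSetoid (X : Set (ℤ → A)) : Setoid (leftRays X) :=
  Setoid.ker fun ξ => future X ξ.1

/-- The states of the Krieger cover: classes of left rays with the same future. -/
def State (X : Set (ℤ → A)) : Type _ :=
  Quotient (futureSetoid X)

/-- The Krieger cover: an edge labeled `s` from `[ξ]` to `[ξ s]` whenever `ξ s` is a left ray
of `X`. -/
def kriegerGraph (X : Set (ℤ → A)) : LabeledGraph (State X) A where
  step p s q := ∃ (ξ : leftRays X) (h : snoc ξ.1 s ∈ leftRays X),
    p = Quotient.mk (futureSetoid X) ξ ∧ q = Quotient.mk (futureSetoid X) ⟨snoc ξ.1 s, h⟩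

end KriegerCover

end

noncomputable section

namespace KriegerCover

/-! ### Counting words and paths -/

section Counting

variable {A V : Type*}

/-! Since edges leaving a state carry different labels, `(T ^ n)_{i,j}` counts the words that label
paths of length `n` from `i` to `j` (`matPow_adjacency`). All of them are words of `X`
(`mem_words_of_isPath`), so every entry is at most `|words X n|`. Conversely each word labels a path
between two of the first `N = coverNumber e n` states, so domination gives `|words X n| ≤ N ^ 2 * (T
^ n)_{i₀,j₀}` (`ncard_words_le_mul_coverNumber_sq`). As `log N / n → 0`, the dominating entry grows
at the rate `h` of the entropy, which exists by subadditivity. Irreducibility carries this rate to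
all other entries, so the Perron value is `exp h`. -/

lemma length_of_mem_words {X : Set (ℤ → A)} {n : ℕ} {w : List A} (hw : w ∈ words X n) :
    w.length = n := by
  obtain ⟨x, -, a, rfl⟩ := hw
  simp

lemma words_finite [Finite A] (X : Set (ℤ → A)) (n : ℕ) : (words X n).Finite :=
  (List.finite_length_eq A n).subset fun _ hw => length_of_mem_words hw

lemma words_nonempty {X : Set (ℤ → A)} (hX : X.Nonempty) (n : ℕ) : (words X n).Nonempty := by
  obtain ⟨x, hx⟩ := hX
  exact ⟨_, x, hx, 0, rfl⟩

lemma ncard_words_add_le [Finite A] (X : Set (ℤ → A)) (m n : ℕ) :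
    (words X (m + n)).ncard ≤ (words X m).ncard * (words X n).ncard := by
  rw [← Set.ncard_prod]
  have hsub : words X (m + n) ⊆
      (fun p : List A × List A => p.1 ++ p.2) '' (words X m ×ˢ words X n) := by
    rintro _ ⟨x, hx, a, rfl⟩
    refine ⟨(List.ofFn fun k : Fin m => x (a + (k : ℕ)),
      List.ofFn fun k : Fin n => x (a + m + (k : ℕ))), ⟨⟨x, hx, a, rfl⟩, ⟨x, hx, a + m, rfl⟩⟩, ?_⟩
    simp [List.ofFn_add, add_assoc]
  have hfin := (words_finite X m).prod (words_finite X n)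
  exact (Set.ncard_le_ncard hsub (hfin.image _)).trans (Set.ncard_image_le hfin)

/-- The entropy of a nonempty set of two-sided sequences exists, by Fekete's lemma. -/
lemma exists_hasTopologicalEntropy [Finite A] {X : Set (ℤ → A)} (hX : X.Nonempty) :
    ∃ h, HasTopologicalEntropy X h := by
  have hpos (n : ℕ) : ((words X n).ncard : ℝ) ≠ 0 := by
    have := (Set.ncard_pos (words_finite X n)).2 (words_nonempty hX n)
    positivity
  have hsub : Subadditive fun n => Real.log ((words X n).ncard : ℝ) := by
    intro m n
    rw [← Real.log_mul (hpos m) (hpos n)]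
    apply Real.log_le_log
    · exact lt_of_le_of_ne (by positivity) (hpos _).symm
    · exact_mod_cast ncard_words_add_le X m n
  refine ⟨_, hsub.tendsto_lim ⟨0, ?_⟩⟩
  rintro _ ⟨n, rfl⟩
  exact div_nonneg (Real.log_natCast_nonneg _) (Nat.cast_nonneg _)

/-- Among all intermediate states after `m` steps, only `k` is kept. -/
lemma matPow_mul_le (T : V → V → ℝ≥0∞) (m n : ℕ) (i k j : V) :
    matPow T m i k * matPow T n k j ≤ matPow T (m + n) i j := by
  induction n generalizing j with
  | zero =>
    by_cases h : j = k
    · subst h; simp [matPow]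
    · simp [matPow, h]
  | succ n ih =>
    rw [← add_assoc, matPow, matPow, ← ENNReal.tsum_mul_left]
    refine ENNReal.tsum_le_tsum fun l => ?_
    rw [← mul_assoc]
    gcongr
    exact ih l

namespace LabeledGraph

variable {G : LabeledGraph V A}

lemma isPath_append {i j : V} {u v : List A} :
    G.IsPath i (u ++ v) j ↔ ∃ k, G.IsPath i u k ∧ G.IsPath k v j := by
  induction u generalizing i with
  | nil => simp [IsPath]
  | cons s u ih =>
    simp only [List.cons_append, IsPath, ih]
    grind

lemma isPath_singleton {i j : V} {s : A} : G.IsPath i [s] j ↔ G.step i s j := by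
  simp [IsPath]

lemma IsRightResolving.isPath_unique (hG : G.IsRightResolving) {i j j' : V} {w : List A}
    (h : G.IsPath i w j) (h' : G.IsPath i w j') : j = j' := by
  induction w generalizing i with
  | nil => exact h.symm.trans h'
  | cons s w ih =>
    obtain ⟨k, hk, h⟩ := h
    obtain ⟨k', hk', h'⟩ := h'
    obtain rfl := hG _ _ _ _ hk hk'
    exact ih h h'

variable (G) in
/-- The labels of the paths of length `n` from `i` to `j`. -/
def pathWords (n : ℕ) (i j : V) : Set (List A) :=
  {w | w.length = n ∧ G.IsPath i w j}

/-- The extension of a path by an edge. -/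
def extendPath (n : ℕ) (i j : V) (p : Σ k, G.pathWords n i k × {s | G.step k s j}) :
    G.pathWords (n + 1) i j :=
  ⟨p.2.1.1 ++ [p.2.2.1], by simp [p.2.1.2.1], isPath_append.2
    ⟨p.1, p.2.1.2.2, isPath_singleton.2 p.2.2.2⟩⟩

lemma IsRightResolving.bijective_extendPath (hG : G.IsRightResolving) (n : ℕ) (i j : V) :
    Function.Bijective (extendPath (G := G) n i j) := by
  constructor
  · rintro ⟨k, ⟨u, hu⟩, s, hs⟩ ⟨l, ⟨v, hv⟩, t, ht⟩ h
    have h' : u ++ [s] = v ++ [t] := congrArg Subtype.val h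
    obtain ⟨rfl, h2⟩ := List.append_inj' h' rfl
    obtain rfl : s = t := by simpa using h2
    -- The intermediate state is not recorded in the word, but reading `u` from `i` determines it.
    obtain rfl := hG.isPath_unique hu.2 hv.2
    rfl
  · rintro ⟨w, hw, hp⟩
    obtain ⟨u, s, rfl⟩ : ∃ u s, w = u ++ [s] :=
      ⟨_, _, (List.dropLast_append_getLast (List.ne_nil_of_length_eq_add_one hw)).symm⟩
    obtain ⟨k, hk, hs⟩ := isPath_append.1 hp
    exact ⟨⟨k, ⟨u, by simpa using hw, hk⟩, s, isPath_singleton.1 hs⟩, rfl⟩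

/-- In a right-resolving graph the powers of the adjacency matrix count labels of paths. -/
lemma IsRightResolving.matPow_adjacency (hG : G.IsRightResolving) (n : ℕ) (i j : V) :
    matPow G.adjacency n i j = ((G.pathWords n i j).encard : ℝ≥0∞) := by
  induction n generalizing j with
  | zero =>
    by_cases h : i = j
    · subst h
      have : G.pathWords 0 i i = {[]} := by
        ext w; cases w <;> simp [pathWords, IsPath]
      simp [matPow, this]
    · have : G.pathWords 0 i j = ∅ := by
        ext w; cases w <;> simp [pathWords, IsPath, h]
      simp [matPow, this, Ne.symm h]
  | succ n ih =>
    rw [← ENNReal.tsum_set_one,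
      ← (Equiv.ofBijective _ (hG.bijective_extendPath n i j)).tsum_eq, ENNReal.tsum_sigma', matPow]
    refine tsum_congr fun k => ?_
    rw [ih, adjacency, ENNReal.tsum_prod', ENNReal.tsum_set_one, ENNReal.tsum_set_const]

lemma isPath_ofFn {x : ℤ → A} {v : ℤ → V} (h : ∀ n, G.step (v n) (x n) (v (n + 1)))
    (n : ℕ) (a : ℤ) : G.IsPath (v a) (List.ofFn fun k : Fin n => x (a + (k : ℕ))) (v (a + n)) := by
  induction n generalizing a with
  | zero => simp [IsPath]
  | succ n ih =>
    rw [List.ofFn_succ]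
    refine ⟨v (a + 1), by simpa using h a, ?_⟩
    convert ih (a + 1) using 2
    · ext k; simp only [Fin.val_succ]; congr 1; push_cast; ring
    · push_cast; ring

lemma exists_isPath_of_mem_words {n : ℕ} {w : List A} (hw : w ∈ words G.soficShift n) :
    ∃ i j, G.IsPath i w j := by
  obtain ⟨x, ⟨v, hv⟩, a, rfl⟩ := hw
  exact ⟨_, _, isPath_ofFn hv n a⟩

/-- The infimum in `coverNumber` is attained. -/
lemma coverNumber_spec [Finite A] (e : V → ℕ) (n : ℕ) :
    words G.soficShift n = ⋃ (i : V) (j : V) (_ : e i < G.coverNumber e n)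
      (_ : e j < G.coverNumber e n), G.wordsBetween n i j := by
  refine Nat.sInf_mem (s := {N | words G.soficShift n =
    ⋃ (i : V) (j : V) (_ : e i < N) (_ : e j < N), G.wordsBetween n i j}) ?_
  have hex (w : words G.soficShift n) : ∃ p : V × V, G.IsPath p.1 w p.2 := by
    obtain ⟨i, j, h⟩ := exists_isPath_of_mem_words w.2
    exact ⟨(i, j), h⟩
  choose f hf using hex
  have := (words_finite G.soficShift n).to_subtype
  obtain ⟨N, hN⟩ := (Set.finite_range fun w => max (e (f w).1) (e (f w).2)).bddAbove
  refine ⟨N + 1, Set.Subset.antisymm (fun w hw => ?_) ?_⟩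
  · have h := hN ⟨⟨w, hw⟩, rfl⟩
    simp only [sup_le_iff] at h
    simp only [Set.mem_iUnion]
    exact ⟨_, _, Nat.lt_succ_of_le h.1, Nat.lt_succ_of_le h.2, hw, hf ⟨w, hw⟩⟩
  · simp only [Set.iUnion_subset_iff]
    exact fun _ _ _ _ _ h => h.1

/-- If at most `M` words label paths between any two given states, then there are at most
`M * coverNumber ^ 2` words. -/
lemma ncard_words_le_mul_coverNumber_sq [Finite A] {e : V → ℕ} (he : Function.Injective e)
    {n M : ℕ} (hM : ∀ i j, (G.pathWords n i j).ncard ≤ M) :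
    (words G.soficShift n).ncard ≤ M * G.coverNumber e n ^ 2 := by
  classical
  set N := G.coverNumber e n with hN
  have hex (w : List A) : ∃ p : ℕ × ℕ, w ∈ words G.soficShift n →
      p.1 < N ∧ p.2 < N ∧ ∃ i j, e i = p.1 ∧ e j = p.2 ∧ G.IsPath i w j := by
    by_cases hw : w ∈ words G.soficShift n
    · have hw' := hw
      rw [coverNumber_spec e n] at hw'
      simp only [Set.mem_iUnion] at hw'
      obtain ⟨i, j, hi, hj, h⟩ := hw'
      exact ⟨(e i, e j), fun _ => ⟨hi, hj, i, j, rfl, rfl, h.2⟩⟩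
    · exact ⟨0, fun h => absurd h hw⟩
  choose f hf using hex
  have hfin := words_finite G.soficShift n
  have hpath (i j : V) : (G.pathWords n i j).Finite :=
    (List.finite_length_eq A n).subset fun _ hw => hw.1
  rw [Set.ncard_eq_toFinset_card _ hfin]
  have hcard : (Finset.range N ×ˢ Finset.range N).card = N ^ 2 := by simp [sq]
  rw [← hcard]
  -- The map `f` sends a word to the numbers of its end states, one of `N ^ 2` pairs. By injectivity
  -- of `e`, each fibre consists of labels of paths between two fixed states.
  refine Finset.card_le_mul_card_image_of_maps_to (f := f) (fun w hw => ?_) M fun p _ => ?_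
  · have := hf w (by simpa using hw)
    simp [this.1, this.2.1]
  · obtain h | ⟨w₀, hw₀⟩ := (hfin.toFinset.filter fun w => f w = p).eq_empty_or_nonempty
    · simp [h]
    · simp only [Finset.mem_filter, Set.Finite.mem_toFinset] at hw₀
      obtain ⟨-, -, i, j, hi, hj, -⟩ := hf w₀ hw₀.1
      refine le_trans ?_ (hM i j)
      rw [← Set.ncard_coe_finset]
      refine Set.ncard_le_ncard (fun w hw => ?_) (hpath i j)
      simp only [Finset.coe_filter, Set.Finite.mem_toFinset, Set.mem_ofPred_eq] at hw
      obtain ⟨-, -, i', j', hi', hj', h⟩ := hf w hw.1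
      obtain rfl : i' = i := he (by rw [hi', hi, hw.2, hw₀.2])
      obtain rfl : j' = j := he (by rw [hj', hj, hw.2, hw₀.2])
      exact ⟨length_of_mem_words hw.1, h⟩

end LabeledGraph

end Counting

/-! ### The Krieger cover presents the shift -/

section Presentation

variable {A : Type*} {X : Set (ℤ → A)}

/-- Moving the symbol `s` across the origin is a shift by one; the `casesOn` term is the right ray
`sη`. -/
lemma join_snoc (ξ η : ℕ → A) (s : A) (n : ℤ) :
    join (snoc ξ s) η n = join ξ (fun k => k.casesOn s η) (n + 1) := by
  unfold join
  rcases lt_trichotomy n 0 with h | rfl | h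
  · obtain ⟨k, rfl⟩ : ∃ k : ℕ, n = -(k + 1 : ℕ) := ⟨(-n - 1).toNat, by omega⟩
    have h1 : (-(-((k + 1 : ℕ) : ℤ))).toNat = k + 1 := by omega
    have h2 : (-(-((k + 1 : ℕ) : ℤ) + 1)).toNat = k := by omega
    rw [if_pos (by omega), if_pos (by omega), h1, h2, snoc]
  · simp [snoc]
  · obtain ⟨k, rfl⟩ : ∃ k : ℕ, n = (k + 1 : ℕ) := ⟨(n - 1).toNat, by omega⟩
    have h1 : (((k + 1 : ℕ) : ℤ) - 1).toNat = k := by omega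
    have h2 : (((k + 1 : ℕ) : ℤ) + 1 - 1).toNat = k + 1 := by omega
    rw [if_neg (by omega), if_neg (by omega), h1, h2]

/-- The successive edges of a path may use unrelated representatives of the states, so no single
left ray follows the path. The future depends only on the class, however, so a right ray can be
built backwards from the end of the path. -/
lemma exists_future_of_isPath (hinv : ∀ x ∈ X, ∀ a : ℤ, (fun n => x (a + n)) ∈ X)
    {w : List A} {ξ : leftRays X} {q : State X}
    (h : (kriegerGraph X).IsPath (Quotient.mk (futureSetoid X) ξ) w q) :
    ∃ η ∈ future X ξ.1, w = List.ofFn fun k : Fin w.length => η k := by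
  induction w generalizing ξ with
  | nil =>
    obtain ⟨η, hη⟩ := ξ.2
    exact ⟨η, hη, by simp⟩
  | cons s w ih =>
    obtain ⟨_, ⟨ξ', hξ', h1, rfl⟩, h2⟩ := h
    obtain ⟨η, hη, hw⟩ := ih h2
    have hF : future X ξ.1 = future X ξ'.1 := Quotient.exact h1
    refine ⟨fun k => k.casesOn s η, ?_, ?_⟩
    · rw [hF]
      have := hinv _ hη (-1)
      simp only [join_snoc, neg_add_cancel_comm] at this
      exact this
    · simpa [List.ofFn_succ] using hw

lemma mem_words_of_isPath (hinv : ∀ x ∈ X, ∀ a : ℤ, (fun n => x (a + n)) ∈ X)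
    {w : List A} {p q : State X} (h : (kriegerGraph X).IsPath p w q) :
    w ∈ words X w.length := by
  induction p using Quotient.inductionOn with
  | h ξ =>
    obtain ⟨η, hη, hw⟩ := exists_future_of_isPath hinv h
    refine ⟨_, hη, 1, hw.trans ?_⟩
    congr 1
    ext k
    simp [join, show ¬ (1 + (k : ℤ) ≤ 0) by omega]

/-- A point `x` is read along the classes of its own pasts: the state at time `n` is the class of
the left ray ending in `x (n - 1)`. -/
lemma subset_soficShift (hinv : ∀ x ∈ X, ∀ a : ℤ, (fun n => x (a + n)) ∈ X) :
    X ⊆ (kriegerGraph X).soficShift := by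
  intro x hx
  have hray (n : ℤ) : (fun k : ℕ => x (n - 1 - k)) ∈ leftRays X := by
    refine ⟨fun k => x (n + k), ?_⟩
    convert hinv x hx (n - 1) using 1
    ext m
    unfold join
    split_ifs with h <;> dsimp only <;> congr 1 <;> omega
  refine ⟨fun n => Quotient.mk (futureSetoid X) ⟨_, hray n⟩, fun n => ?_⟩
  have hs : snoc (fun k : ℕ => x (n - 1 - k)) (x n) = fun k : ℕ => x (n + 1 - 1 - k) := by
    ext k
    cases k with
    | zero => simp [snoc]
    | succ k => simp only [snoc]; congr 1; push_cast; ring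
  refine ⟨⟨_, hray n⟩, hs ▸ hray (n + 1), rfl, ?_⟩
  exact congrArg (Quotient.mk (futureSetoid X)) (Subtype.ext hs.symm)

/-- This links `coverNumber`, defined through the graph, with the entropy of `X`. Comparing finite
words suffices, so no limit of points is taken. -/
lemma words_soficShift (hinv : ∀ x ∈ X, ∀ a : ℤ, (fun n => x (a + n)) ∈ X) (n : ℕ) :
    words (kriegerGraph X).soficShift n = words X n := by
  apply Set.Subset.antisymm
  · intro w hw
    obtain ⟨i, j, h⟩ := LabeledGraph.exists_isPath_of_mem_words hw
    rw [← length_of_mem_words hw]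
    exact mem_words_of_isPath hinv h
  · rintro _ ⟨x, hx, a, rfl⟩
    exact ⟨x, subset_soficShift hinv hx, a, rfl⟩

end Presentation

/-! ### Exponential growth rates -/

section Growth

/-- Nonnegativity bounds the lower limit below by `0`. -/
lemma tendsto_of_limsup_coe_eq_zero {u : ℕ → ℝ} (h0 : ∀ n, 0 ≤ u n)
    (h : limsup (fun n => (u n : EReal)) atTop = 0) : Tendsto u atTop (𝓝 0) := by
  have : Tendsto (fun n => (u n : EReal)) atTop (𝓝 ((0 : ℝ) : EReal)) := by
    refine tendsto_of_le_liminf_of_limsup_le ?_ h.le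
    exact le_liminf_of_le (by isBoundedDefault) (Eventually.of_forall fun n => by
      exact_mod_cast h0 n)
  exact EReal.tendsto_coe.1 this

/-- Growth rates do not change when the index is shifted. -/
lemma tendsto_log_div_add {t : ℕ → ℕ} {h : ℝ}
    (ht : Tendsto (fun n => Real.log (t n : ℝ) / (n : ℝ)) atTop (𝓝 h)) (d : ℕ) :
    Tendsto (fun n => Real.log (t n : ℝ) / ((n + d : ℕ) : ℝ)) atTop (𝓝 h) := by
  have h1 : Tendsto (fun n : ℕ => (n : ℝ) / (n + (d : ℝ))) atTop (𝓝 1) :=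
    tendsto_natCast_div_add_atTop (d : ℝ)
  have h2 := ht.mul h1
  rw [mul_one] at h2
  refine h2.congr' ?_
  filter_upwards [eventually_gt_atTop 0] with n hn
  have : (n : ℝ) ≠ 0 := by positivity
  push_cast
  field_simp

lemma tendsto_rpow_one_div {u : ℕ → ℕ} {h : ℝ} (hu : ∀ᶠ n in atTop, 1 ≤ u n)
    (ht : Tendsto (fun n => Real.log (u n : ℝ) / (n : ℝ)) atTop (𝓝 h)) :
    Tendsto (fun n : ℕ => (u n : ℝ≥0∞) ^ (1 / (n : ℝ))) atTop (𝓝 (ENNReal.ofReal (Real.exp h))) := by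
  refine (ENNReal.tendsto_ofReal ((Real.continuous_exp.tendsto h).comp ht)).congr' ?_
  filter_upwards [hu] with n hn
  have hpos : (0 : ℝ) < u n := by exact_mod_cast hn
  rw [← ENNReal.ofReal_natCast, ENNReal.ofReal_rpow_of_pos hpos, Real.rpow_def_of_pos hpos]
  simp [div_eq_mul_inv]

end Growth

end KriegerCover

end

/-! ### The entropy theorem -/

open KriegerCover in
theorem theorem6p2 {A : Type*} [Finite A] [TopologicalSpace A] [DiscreteTopology A]
    (X : SymbolicDynamics.FullShift.Subshift A ℤ)
    (hX : KriegerCover.IsIrreducibleShift X.carrier)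
    (hres : (KriegerCover.kriegerGraph X.carrier).IsRightResolving)
    (e : KriegerCover.State X.carrier → ℕ) (he : Function.Injective e)
    (T : KriegerCover.State X.carrier → KriegerCover.State X.carrier → ℝ≥0∞)
    (hT : T = (KriegerCover.kriegerGraph X.carrier).adjacency)
    (hirr : KriegerCover.IsIrreducibleMatrix T)
    (haper : KriegerCover.IsAperiodicMatrix T)
    (hpos : KriegerCover.IsPositiveRecurrentMatrix T)
    (hN : limsup (fun n : ℕ =>
      ((Real.log ((KriegerCover.kriegerGraph X.carrier).coverNumber e n : ℝ) / (n : ℝ) : ℝ) :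
        EReal)) atTop = 0)
    (hdom : ∃ i₀ j₀, ∀ n, 1 ≤ n → ∀ i j, (i, j) ≠ (i₀, j₀) →
      KriegerCover.matPow T n i j ≤ KriegerCover.matPow T n i₀ j₀) :
    KriegerCover.perronValue T ≠ ∞ ∧
      (∀ i j, Tendsto (fun n : ℕ => KriegerCover.matPow T n i j ^ (1 / (n : ℝ))) atTop
        (𝓝 (KriegerCover.perronValue T))) ∧
      KriegerCover.HasTopologicalEntropy X.carrier
        (Real.log (KriegerCover.perronValue T).toReal) := by
  obtain ⟨i₀, j₀, hdom⟩ := hdom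
  set G := kriegerGraph X.carrier with hG
  have hinv : ∀ x ∈ X.carrier, ∀ a : ℤ, (fun n => x (a + n)) ∈ X.carrier :=
    fun x hx a => X.mapsTo a hx
  have hne : X.carrier.Nonempty := by
    obtain ⟨ξ, -⟩ := Quotient.exists_rep i₀
    obtain ⟨η, hη⟩ := ξ.2
    exact ⟨_, hη⟩
  obtain ⟨h, hh⟩ := exists_hasTopologicalEntropy hne
  -- the number of paths, as natural numbers
  set c : State X.carrier → State X.carrier → ℕ → ℕ := fun i j n => (G.pathWords n i j).ncard with hc
  have hsub (n i j) : G.pathWords n i j ⊆ words X.carrier n := fun w hw =>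
    hw.1 ▸ mem_words_of_isPath hinv hw.2
  have hpow (n i j) : matPow T n i j = (c i j n : ℝ≥0∞) := by
    rw [hT, hres.matPow_adjacency,
      ← ((words_finite _ n).subset (hsub n i j)).cast_ncard_eq, ENat.toENNReal_coe]
  have hcle (n i j) : c i j n ≤ (words X.carrier n).ncard :=
    Set.ncard_le_ncard (hsub n i j) (words_finite _ n)
  have hmax (n : ℕ) (hn : 1 ≤ n) (i j) : c i j n ≤ c i₀ j₀ n := by
    by_cases hij : (i, j) = (i₀, j₀)
    · obtain ⟨rfl, rfl⟩ := Prod.mk.inj hij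
      exact le_rfl
    · have := hdom n hn i j hij
      rw [hpow, hpow] at this
      exact_mod_cast this
  have hcover (n : ℕ) (hn : 1 ≤ n) :
      (words X.carrier n).ncard ≤ c i₀ j₀ n * G.coverNumber e n ^ 2 := by
    rw [← words_soficShift hinv]
    exact LabeledGraph.ncard_words_le_mul_coverNumber_sq he (hmax n hn)
  have hword (n : ℕ) : 0 < (words X.carrier n).ncard :=
    (Set.ncard_pos (words_finite _ n)).2 (words_nonempty hne n)
  have hNlim : Tendsto (fun n : ℕ => Real.log (G.coverNumber e n : ℝ) / (n : ℝ)) atTop (𝓝 0) :=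
    tendsto_of_limsup_coe_eq_zero
      (fun n => div_nonneg (Real.log_natCast_nonneg _) (Nat.cast_nonneg _)) hN
  have hc₀ (n : ℕ) (hn : 1 ≤ n) : 1 ≤ c i₀ j₀ n :=
    Nat.pos_of_mul_pos_right ((hword n).trans_le (hcover n hn))
  -- Squeeze: `log |words| - 2 log N ≤ log c ≤ log |words|`, divided by `n`.
  have hlim₀ : Tendsto (fun n : ℕ => Real.log (c i₀ j₀ n : ℝ) / (n : ℝ)) atTop (𝓝 h) := by
    have hlow := hh.sub (hNlim.const_mul 2)
    rw [mul_zero, sub_zero] at hlow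
    refine tendsto_of_tendsto_of_tendsto_of_le_of_le' hlow hh ?_ ?_
    · filter_upwards [eventually_ge_atTop 1] with n hn
      have h1 : (0 : ℝ) < (words X.carrier n).ncard := by exact_mod_cast hword n
      have h2 : (0 : ℝ) < c i₀ j₀ n := by exact_mod_cast hc₀ n hn
      have h3 : (0 : ℝ) < (G.coverNumber e n : ℝ) ^ 2 := by
        have := Nat.pos_of_mul_pos_left ((hword n).trans_le (hcover n hn))
        exact_mod_cast this
      have h4 : Real.log ((words X.carrier n).ncard : ℝ) ≤
          Real.log (c i₀ j₀ n : ℝ) + 2 * Real.log (G.coverNumber e n : ℝ) := by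
        have h5 : ((words X.carrier n).ncard : ℝ) ≤ c i₀ j₀ n * (G.coverNumber e n : ℝ) ^ 2 := by
          exact_mod_cast hcover n hn
        have h6 := Real.log_le_log h1 h5
        rw [Real.log_mul h2.ne' h3.ne', Real.log_pow] at h6
        exact_mod_cast h6
      rw [← mul_div_assoc, ← sub_div]
      gcongr
      linarith
    · filter_upwards [eventually_ge_atTop 1] with n hn
      gcongr
      · exact_mod_cast hc₀ n hn
      · exact hcle n i₀ j₀
  -- comparison of arbitrary entries with the dominating one
  have hcomp (i j) : ∃ d, ∀ n, 1 ≤ n → c i₀ j₀ n ≤ c i j (n + d) := by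
    obtain ⟨a, -, ha⟩ := hirr i i₀
    obtain ⟨b, -, hb⟩ := hirr j₀ j
    -- Paths from `i₀` to `j₀` are extended by fixed paths from `i` to `i₀` and from `j₀` to `j`, of
    -- lengths `a` and `b`.
    refine ⟨a + b, fun n _ => ?_⟩
    have hab := (mul_le_mul_left (matPow_mul_le T a n i i₀ j₀) (matPow T b j₀ j)).trans
      (matPow_mul_le T (a + n) b i j₀ j)
    rw [show a + n + b = n + (a + b) by omega] at hab
    simp only [hpow] at hab ha hb
    have ha' : 1 ≤ c i i₀ a := by exact_mod_cast ha
    have hb' : 1 ≤ c j₀ j b := by exact_mod_cast hb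
    have hab' : c i i₀ a * c i₀ j₀ n * c j₀ j b ≤ c i j (n + (a + b)) := by exact_mod_cast hab
    refine le_trans ?_ hab'
    calc c i₀ j₀ n = 1 * c i₀ j₀ n * 1 := by ring
      _ ≤ _ := by gcongr
  have hlim (i j) : Tendsto (fun n : ℕ => matPow T n i j ^ (1 / (n : ℝ))) atTop
      (𝓝 (ENNReal.ofReal (Real.exp h))) := by
    obtain ⟨d, hd⟩ := hcomp i j
    simp only [hpow]
    refine tendsto_rpow_one_div ?_ ?_
    · filter_upwards [eventually_ge_atTop (1 + d)] with n hn
      obtain ⟨m, rfl⟩ := Nat.exists_eq_add_of_le' (le_of_add_le_right hn)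
      exact (hc₀ m (by omega)).trans (hd m (by omega))
    -- After the shift by `d`, the entry lies between `c i₀ j₀ n` and `c i₀ j₀ (n + d)`.
    · rw [← tendsto_add_atTop_iff_nat d]
      refine tendsto_of_tendsto_of_tendsto_of_le_of_le' (tendsto_log_div_add hlim₀ d)
        ((tendsto_add_atTop_iff_nat d).2 hlim₀) ?_ ?_
      · filter_upwards [eventually_ge_atTop 1] with n hn
        gcongr
        · exact_mod_cast hc₀ n hn
        · exact hd n hn
      · filter_upwards [eventually_ge_atTop 1] with n hn
        gcongr
        · exact_mod_cast (hc₀ n hn).trans (hd n hn)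
        · exact hmax _ (by omega) i j
  have hperron : perronValue T = ENNReal.ofReal (Real.exp h) := by
    have : Nonempty (State X.carrier) := ⟨i₀⟩
    simp only [perronValue, (hlim _ _).limsup_eq, ciSup_const]
  rw [hperron, ENNReal.toReal_ofReal (Real.exp_pos h).le, Real.log_exp]
  exact ⟨ENNReal.ofReal_ne_top, hlim, hh⟩
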